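/- Let $k\ge 2$ be an integer, let $a\in\mathbb{C}$ with $0<|a|<1$, and let $f(z)=\dfrac{z^k+a}{1+\overline{a}z^k}$. Write $f^n$ for the $n$-th iterate of $f$ and $\mathbb{D}=\{z\in\mathbb{C}:|z|<1\}$. A fixed point $p$ of a map $g$ holomorphic near $p$ is called parabolic if $g'(p)$ is a root of unity and no iterate $g^n$, $n\ge 1$, is the identity near $p$. Then: (i) $\frac{a}{|a|}$ is a fixed point of $f$ if and only if $\left(\frac{a}{|a|}\right)^{k-1}=1$, i.e. $\frac{a}{|a|}$ is a $(k-1)$-th root of unity. (ii) If $\frac{a}{|a|}$ is a $(k-1)$-th root of unity, then $\frac{a}{|a|}$ is a parabolic fixed point of $f$ if and only if $|a|=\frac{k-1}{k+1}$. (iii) If $\frac{a}{|a|}$ is a $(k-1)$-th root of unity and $\frac{a}{|a|}$ is a parabolic fixed point of $f$, then $f^n(z)\to\frac{a}{|a|}$ as $n\to\infty$ for every $z\in\mathbb{D}$. -/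

import Mathlib

/-- The map `z ↦ (z ^ k + a) / (1 + conj a * z ^ k)`. For `0 < ‖a‖ < 1` and `k ≥ 2` its poles lie
strictly outside the closed unit disk, which the map sends into itself, so the value that Lean's
division gives at a pole is irrelevant for orbits of points of the open disk and for germs at
points of the unit circle. -/
noncomputable def blaschkeMap (k : ℕ) (a : ℂ) (z : ℂ) : ℂ :=
  (z ^ k + a) / (1 + (starRingEnd ℂ) a * z ^ k)

/-- A parabolic fixed point of a map `g` holomorphic near `p`: `g p = p`, the multiplier `g' p` is a
root of unity, and no iterate `g^[n]` with `n ≥ 1` is the identity near `p`. -/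
def IsParabolicFixedPoint (g : ℂ → ℂ) (p : ℂ) : Prop :=
  AnalyticAt ℂ g p ∧ Function.IsFixedPt g p ∧
    (∃ n : ℕ, 0 < n ∧ deriv g p ^ n = 1) ∧
    ∀ n : ℕ, 0 < n → ¬ (∀ᶠ z in nhds p, g^[n] z = z)

/-!
Write `a = r u` with `r = ‖a‖` and `‖u‖ = 1`. The fixed point equation at `u` reduces to
`(u ^ (k - 1) - 1) * (1 - r) = 0`. When `u ^ (k - 1) = 1`, the rotation by `u` conjugates
`blaschkeMap k a` to the real map `w ↦ (w ^ k + r) / (1 + r * w ^ k)`, whose multiplier at `1` is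
the positive number `k (1 - r) / (1 + r)`. A positive number is a root of unity only if it is `1`,
that is, `r = (k - 1) / (k + 1)`.

At this parameter the dynamics is controlled by the horocyclic ratio
`h(z) = ‖u - z‖² / (1 - ‖z‖²)`, the reciprocal of the Poisson kernel with pole `u`. The Möbius map
`t ↦ (t + r) / (1 + r t)` multiplies it by `(1 - r) / (1 + r) = 1 / k` (`horoRatio_moebius`), while
`w ↦ w ^ k` multiplies it by a factor strictly less than `k` (`horoRatio_pow_lt`), by the strict
Cauchy–Schwarz inequality for `1 + w + ⋯ + w ^ (k - 1)`. Hence `h` strictly decreases along orbits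
in the disk (`horoRatio_blaschkeMap_lt`). So no iterate is the identity near `u`. Moreover a
cluster point of an orbit can neither lie inside the disk, where `h` would be stationary under the
map, nor on the circle away from `u`, where `h` would be unbounded; by compactness the orbit
converges to `u`.
-/

/-- The ratio `‖u - z‖² / (1 - ‖z‖²)`, for `‖u‖ = 1` and `‖z‖ < 1` the reciprocal of the Poisson
kernel with pole `u`; its sublevel sets in the disk are the horodisks at `u`. -/
noncomputable def horoRatio (u z : ℂ) : ℝ := ‖u - z‖ ^ 2 / (1 - ‖z‖ ^ 2)

theorem sq_geom_sum_lt {k : ℕ} (hk : 2 ≤ k) {x : ℝ} (hx : x < 1) :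
    (∑ j ∈ Finset.range k, x ^ j) ^ 2 < k * ∑ j ∈ Finset.range k, (x ^ 2) ^ j := by
  induction k, hk using Nat.le_induction with
  | base =>
    simp only [Finset.sum_range_succ, Finset.sum_range_zero]
    push_cast
    nlinarith [sq_pos_of_pos (sub_pos.2 hx)]
  | succ n _ ih =>
    -- The defect of the inequality grows by `∑ (x ^ j - x ^ n) ^ 2`.
    have h : 0 ≤ ∑ j ∈ Finset.range n, (x ^ j - x ^ n) ^ 2 :=
      Finset.sum_nonneg fun _ _ => sq_nonneg _
    have e : ∑ j ∈ Finset.range n, (x ^ j - x ^ n) ^ 2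
        = ∑ j ∈ Finset.range n, (x ^ 2) ^ j - 2 * x ^ n * ∑ j ∈ Finset.range n, x ^ j
          + n * (x ^ n) ^ 2 := by
      have hc : (n : ℝ) * (x ^ n) ^ 2 = ∑ _j ∈ Finset.range n, (x ^ n) ^ 2 := by simp
      rw [hc, Finset.mul_sum, ← Finset.sum_sub_distrib, ← Finset.sum_add_distrib]
      refine Finset.sum_congr rfl fun j _ => ?_
      ring
    rw [Finset.sum_range_succ, Finset.sum_range_succ, pow_right_comm x 2 n]
    push_cast
    nlinarith

theorem horoRatio_pow_lt {k : ℕ} (hk : 2 ≤ k) {w : ℂ} (hw : ‖w‖ < 1) :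
    horoRatio 1 (w ^ k) < k * horoRatio 1 w := by
  have hw2 : 0 < 1 - ‖w‖ ^ 2 := by nlinarith [norm_nonneg w]
  have h1 : 0 < ‖(1 : ℂ) - w‖ := by
    rw [norm_pos_iff, sub_ne_zero]
    rintro rfl
    simp at hw
  have hS : 0 < ∑ j ∈ Finset.range k, (‖w‖ ^ 2) ^ j :=
    Finset.sum_pos' (fun _ _ => by positivity) ⟨0, Finset.mem_range.2 (by omega), by simp⟩
  have hn : ‖∑ j ∈ Finset.range k, w ^ j‖ ^ 2 < k * ∑ j ∈ Finset.range k, (‖w‖ ^ 2) ^ j := by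
    refine lt_of_le_of_lt ?_ (sq_geom_sum_lt hk hw)
    gcongr
    exact (norm_sum_le _ _).trans_eq (by simp)
  have e1 : (1 : ℂ) - w ^ k = (1 - w) * ∑ j ∈ Finset.range k, w ^ j := (mul_neg_geom_sum w k).symm
  have e2 : 1 - ‖w ^ k‖ ^ 2 = (1 - ‖w‖ ^ 2) * ∑ j ∈ Finset.range k, (‖w‖ ^ 2) ^ j := by
    rw [mul_neg_geom_sum, norm_pow, pow_right_comm]
  unfold horoRatio
  rw [e2, e1, norm_mul, mul_pow, ← mul_div_assoc, div_lt_div_iff₀ (by positivity) hw2]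
  have := mul_lt_mul_of_pos_left hn (by positivity : 0 < ‖1 - w‖ ^ 2 * (1 - ‖w‖ ^ 2))
  linarith

theorem one_add_mul_ne_zero {r : ℝ} (hr₀ : 0 ≤ r) (hr₁ : r < 1) {t : ℂ} (ht : ‖t‖ ≤ 1) :
    1 + (r : ℂ) * t ≠ 0 := by
  intro h
  have h' : ‖(r : ℂ) * t‖ = 1 := by
    rw [show (r : ℂ) * t = -1 by linear_combination h]
    simp
  rw [norm_mul, Complex.norm_of_nonneg hr₀] at h'
  nlinarith [norm_nonneg t]

theorem one_sub_sq_norm_moebius {r : ℝ} (hr₀ : 0 ≤ r) (hr₁ : r < 1) {t : ℂ} (ht : ‖t‖ ≤ 1) :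
    1 - ‖(t + r) / (1 + r * t)‖ ^ 2 = (1 - r ^ 2) * (1 - ‖t‖ ^ 2) / ‖1 + r * t‖ ^ 2 := by
  have h := norm_pos_iff.2 (one_add_mul_ne_zero hr₀ hr₁ ht)
  rw [norm_div, div_pow, eq_div_iff (by positivity), sub_mul, div_mul_cancel₀ _ (by positivity)]
  simp only [Complex.sq_norm, Complex.normSq_apply, Complex.add_re, Complex.add_im,
    Complex.mul_re, Complex.mul_im, Complex.ofReal_re, Complex.ofReal_im, Complex.one_re,
    Complex.one_im]
  ring

theorem horoRatio_moebius {r : ℝ} (hr₀ : 0 ≤ r) (hr₁ : r < 1) {t : ℂ} (ht : ‖t‖ < 1) :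
    horoRatio 1 ((t + r) / (1 + r * t)) = (1 - r) / (1 + r) * horoRatio 1 t := by
  have h0 := one_add_mul_ne_zero hr₀ hr₁ ht.le
  have h := norm_pos_iff.2 h0
  have ht2 : 0 < 1 - ‖t‖ ^ 2 := by nlinarith [norm_nonneg t]
  have e : 1 - (t + r) / (1 + r * t) = ((1 - r : ℝ) : ℂ) * (1 - t) / (1 + r * t) := by
    rw [eq_div_iff h0, sub_mul, div_mul_cancel₀ _ h0]
    push_cast
    ring
  unfold horoRatio
  rw [one_sub_sq_norm_moebius hr₀ hr₁ ht.le, e, norm_div, norm_mul,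
    Complex.norm_of_nonneg (by linarith : 0 ≤ 1 - r)]
  have h1 : 1 + r ≠ 0 := by positivity
  have h2 : 1 - r ≠ 0 := by linarith
  have h3 : 1 - r ^ 2 ≠ 0 := by nlinarith
  have h4 := h.ne'
  have h5 := ht2.ne'
  generalize ‖1 + (r : ℂ) * t‖ = d at h4
  field_simp
  ring

theorem horoRatio_mul {u : ℂ} (hu : ‖u‖ = 1) (w : ℂ) :
    horoRatio u (u * w) = horoRatio 1 w := by
  unfold horoRatio
  rw [show u - u * w = u * (1 - w) by ring, norm_mul, norm_mul, hu, one_mul, one_mul]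

theorem conj_mul_self_of_norm_one {u : ℂ} (hu : ‖u‖ = 1) : (starRingEnd ℂ) u * u = 1 := by
  rw [Complex.conj_mul', hu]
  simp

/-- The denominator of the map has no zero in the closed unit disk. -/
theorem blaschkeMap_denom_ne_zero {k : ℕ} {a : ℂ} (ha : ‖a‖ < 1) {z : ℂ} (hz : ‖z‖ ≤ 1) :
    1 + (starRingEnd ℂ) a * z ^ k ≠ 0 := by
  intro h
  have h' : ‖(starRingEnd ℂ) a * z ^ k‖ = 1 := by
    rw [show (starRingEnd ℂ) a * z ^ k = -1 by linear_combination h]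
    simp
  rw [norm_mul, RCLike.norm_conj, norm_pow] at h'
  nlinarith [norm_nonneg a, pow_le_one₀ (norm_nonneg z) hz (n := k)]

theorem blaschkeMap_analyticAt {k : ℕ} {a : ℂ} (ha : ‖a‖ < 1) {z : ℂ} (hz : ‖z‖ ≤ 1) :
    AnalyticAt ℂ (blaschkeMap k a) z := by
  unfold blaschkeMap
  exact ((analyticAt_id.pow k).add analyticAt_const).div
    (analyticAt_const.add (analyticAt_const.mul (analyticAt_id.pow k)))
    (blaschkeMap_denom_ne_zero ha hz)

/-- If `u ^ k = u`, the rotation by `u` conjugates the map with parameter `r * u` to the one with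
parameter `r`. -/
theorem blaschkeMap_mul {k : ℕ} {u : ℂ} (hu : ‖u‖ = 1) (huk : u ^ k = u) (r : ℝ) (w : ℂ) :
    blaschkeMap k (r * u) (u * w) = u * ((w ^ k + r) / (1 + r * w ^ k)) := by
  unfold blaschkeMap
  have e : 1 + (starRingEnd ℂ) (r * u) * (u * w) ^ k = 1 + r * w ^ k := by
    rw [map_mul, Complex.conj_ofReal, mul_pow, huk]
    linear_combination (r : ℂ) * w ^ k * conj_mul_self_of_norm_one hu
  rw [e, mul_pow, huk]
  ring

theorem norm_blaschkeMap_lt_one {k : ℕ} (hk : k ≠ 0) {u : ℂ} (hu : ‖u‖ = 1) (huk : u ^ k = u)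
    {r : ℝ} (hr₀ : 0 ≤ r) (hr₁ : r < 1) {z : ℂ} (hz : ‖z‖ < 1) :
    ‖blaschkeMap k (r * u) z‖ < 1 := by
  obtain ⟨w, rfl⟩ : ∃ w, z = u * w :=
    ⟨z / u, (mul_div_cancel₀ z (norm_pos_iff.1 (hu ▸ one_pos))).symm⟩
  rw [norm_mul, hu, one_mul] at hz
  have ht : ‖w ^ k‖ < 1 := by
    rw [norm_pow]
    exact pow_lt_one₀ (norm_nonneg w) hz hk
  rw [blaschkeMap_mul hu huk, norm_mul, hu, one_mul]
  have h := norm_pos_iff.2 (one_add_mul_ne_zero hr₀ hr₁ ht.le)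
  have h1 : 0 < 1 - r ^ 2 := by nlinarith
  have h2 : 0 < 1 - ‖w ^ k‖ ^ 2 := by nlinarith [norm_nonneg (w ^ k)]
  have h3 : 0 < 1 - ‖(w ^ k + r) / (1 + r * w ^ k)‖ ^ 2 := by
    rw [one_sub_sq_norm_moebius hr₀ hr₁ ht.le]
    positivity
  nlinarith [norm_nonneg ((w ^ k + r) / (1 + r * w ^ k))]

/-- At the parabolic parameter every point of the disk is moved strictly into its horodisk
at `u`. -/
theorem horoRatio_blaschkeMap_lt {k : ℕ} (hk : 2 ≤ k) {u : ℂ} (hu : ‖u‖ = 1) (huk : u ^ k = u)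
    {r : ℝ} (hr : r = ((k : ℝ) - 1) / (k + 1)) {z : ℂ} (hz : ‖z‖ < 1) :
    horoRatio u (blaschkeMap k (r * u) z) < horoRatio u z := by
  have hk' : (2 : ℝ) ≤ k := by exact_mod_cast hk
  have hr₀ : 0 ≤ r := hr ▸ div_nonneg (by linarith) (by linarith)
  have hr₁ : r < 1 := by rw [hr, div_lt_one (by linarith)]; linarith
  have hrk : (1 - r) / (1 + r) = 1 / k := by
    rw [eq_div_iff (by linarith)] at hr
    rw [div_eq_div_iff (by linarith) (by linarith)]
    linarith
  obtain ⟨w, rfl⟩ : ∃ w, z = u * w :=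
    ⟨z / u, (mul_div_cancel₀ z (norm_pos_iff.1 (hu ▸ one_pos))).symm⟩
  rw [norm_mul, hu, one_mul] at hz
  have ht : ‖w ^ k‖ < 1 := by
    rw [norm_pow]
    exact pow_lt_one₀ (norm_nonneg w) hz (by omega)
  rw [blaschkeMap_mul hu huk, horoRatio_mul hu, horoRatio_mul hu, horoRatio_moebius hr₀ hr₁ ht, hrk,
    one_div, inv_mul_lt_iff₀ (by linarith)]
  exact horoRatio_pow_lt hk hz

theorem continuousAt_horoRatio (u : ℂ) {z : ℂ} (hz : ‖z‖ < 1) : ContinuousAt (horoRatio u) z := by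
  unfold horoRatio
  refine ContinuousAt.div (by fun_prop) (by fun_prop) ?_
  nlinarith [norm_nonneg z]

/-- An orbit in the disk along which the horocyclic ratio at `u` strictly decreases converges
to `u`. -/
theorem tendsto_iterate_of_horoRatio_lt {f : ℂ → ℂ} {u : ℂ}
    (hf : ∀ z, ‖z‖ < 1 → ContinuousAt f z) (hmaps : ∀ z, ‖z‖ < 1 → ‖f z‖ < 1)
    (hlt : ∀ z, ‖z‖ < 1 → horoRatio u (f z) < horoRatio u z) {z : ℂ} (hz : ‖z‖ < 1) :
    Filter.Tendsto (fun n : ℕ => f^[n] z) Filter.atTop (nhds u) := by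
  have hmem : ∀ n, ‖f^[n] z‖ < 1 := fun n => by
    induction n with
    | zero => exact hz
    | succ n ih =>
      rw [Function.iterate_succ_apply']
      exact hmaps _ ih
  have hanti : Antitone fun n => horoRatio u (f^[n] z) := antitone_nat_of_succ_le fun n => by
    rw [Function.iterate_succ_apply']
    exact (hlt _ (hmem n)).le
  have hpos : ∀ n, 0 < 1 - ‖f^[n] z‖ ^ 2 := fun n => by
    nlinarith [norm_nonneg (f^[n] z), hmem n]
  obtain ⟨L, hL⟩ : ∃ L, Filter.Tendsto (fun n => horoRatio u (f^[n] z)) Filter.atTop (nhds L) :=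
    ⟨_, tendsto_atTop_ciInf hanti ⟨0, by
      rintro _ ⟨n, rfl⟩
      exact div_nonneg (sq_nonneg _) (hpos n).le⟩⟩
  refine (isCompact_closedBall (0 : ℂ) 1).tendsto_nhds_of_unique_mapClusterPt
    (Filter.Eventually.of_forall fun n => by simpa using (hmem n).le) fun y hy hcl => ?_
  rw [mem_closedBall_zero_iff] at hy
  obtain ⟨φ, hφ, hlim⟩ := hcl.tendsto_subseq
  rcases hy.lt_or_eq with hy1 | hy1
  · -- Inside the disk both `y` and `f y` would have the limiting ratio `L`.
    exfalso
    have h1 := tendsto_nhds_unique ((continuousAt_horoRatio u hy1).tendsto.comp hlim)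
      (hL.comp hφ.tendsto_atTop)
    have h2 := tendsto_nhds_unique
      ((continuousAt_horoRatio u (hmaps y hy1)).tendsto.comp ((hf y hy1).tendsto.comp hlim))
      (((hL.comp (Filter.tendsto_add_atTop_nat 1)).comp hφ.tendsto_atTop).congr fun n => by
        simp only [Function.comp_apply, Function.iterate_succ_apply'])
    exact (hlt y hy1).ne (h2.trans h1.symm)
  · -- The orbit stays in the horodisk through `z`, whose closure meets the circle only at `u`.
    have hle : ∀ n, ‖u - f^[φ n] z‖ ^ 2 ≤ horoRatio u z * (1 - ‖f^[φ n] z‖ ^ 2) := fun n =>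
      (div_le_iff₀ (hpos _)).1 (hanti (Nat.zero_le (φ n)))
    have h3 : ‖u - y‖ ^ 2 ≤ horoRatio u z * (1 - ‖y‖ ^ 2) :=
      le_of_tendsto_of_tendsto' ((hlim.const_sub u).norm.pow 2)
        (((hlim.norm.pow 2).const_sub 1).const_mul _) hle
    rw [hy1] at h3
    have h4 : ‖u - y‖ = 0 := by
      exact (pow_eq_zero_iff two_ne_zero).1 (le_antisymm (by simpa using h3) (sq_nonneg _))
    exact (sub_eq_zero.1 (norm_eq_zero.1 h4)).symm

/-- Strict decrease of the horocyclic ratio rules out that an iterate is the identity near a point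
of the unit circle. -/
theorem not_eventually_iterate_eq_of_horoRatio_lt {f : ℂ → ℂ} {u : ℂ} (hu : ‖u‖ = 1)
    (hmaps : ∀ z, ‖z‖ < 1 → ‖f z‖ < 1)
    (hlt : ∀ z, ‖z‖ < 1 → horoRatio u (f z) < horoRatio u z) {n : ℕ} (hn : 0 < n) :
    ¬ ∀ᶠ z in nhds u, f^[n] z = z := by
  intro h
  have hcl : u ∈ closure (Metric.ball (0 : ℂ) 1) := by
    rw [closure_ball _ one_ne_zero]
    simpa using hu.le
  obtain ⟨z, hz, hz1⟩ := mem_closure_iff_nhds.1 hcl _ h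
  have key : ∀ m, ‖f^[m + 1] z‖ < 1 ∧ horoRatio u (f^[m + 1] z) < horoRatio u z := fun m => by
    induction m with
    | zero => exact ⟨hmaps z (by simpa using hz1), hlt z (by simpa using hz1)⟩
    | succ m ih =>
      rw [Function.iterate_succ_apply']
      exact ⟨hmaps _ ih.1, (hlt _ ih.1).trans ih.2⟩
  obtain ⟨m, rfl⟩ := Nat.exists_eq_add_one.2 hn
  have hfix : f^[m + 1] z = z := hz
  have := (key m).2
  rw [hfix] at this
  exact lt_irrefl _ this

theorem isFixedPt_blaschkeMap_iff {k : ℕ} (hk : 1 ≤ k) {u : ℂ} (hu : ‖u‖ = 1)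
    {r : ℝ} (hr₀ : 0 ≤ r) (hr₁ : r < 1) :
    Function.IsFixedPt (blaschkeMap k (r * u)) u ↔ u ^ (k - 1) = 1 := by
  obtain ⟨m, rfl⟩ := Nat.exists_eq_add_of_le' hk
  have hu0 : u ≠ 0 := norm_pos_iff.1 (hu ▸ one_pos)
  have hD := blaschkeMap_denom_ne_zero (k := m + 1) (a := r * u) (z := u)
    (by rwa [norm_mul, hu, mul_one, Complex.norm_of_nonneg hr₀]) hu.le
  have hr : (1 : ℂ) - r ≠ 0 := by
    rw [sub_ne_zero]
    exact_mod_cast hr₁.ne'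
  have hc := conj_mul_self_of_norm_one hu
  rw [Function.IsFixedPt, blaschkeMap, div_eq_iff hD, Nat.add_sub_cancel, map_mul,
    Complex.conj_ofReal, ← sub_eq_zero,
    show u ^ (m + 1) + r * u - u * (1 + r * (starRingEnd ℂ) u * u ^ (m + 1))
      = u * (1 - r) * (u ^ m - 1) by linear_combination (-(r : ℂ) * u ^ (m + 1)) * hc,
    mul_eq_zero, sub_eq_zero (b := (1 : ℂ))]
  simp [hu0, hr]

theorem deriv_blaschkeMap {k : ℕ} (hk : 1 ≤ k) {u : ℂ} (hu : ‖u‖ = 1) (huk : u ^ (k - 1) = 1)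
    {r : ℝ} (hr₀ : 0 ≤ r) (hr₁ : r < 1) :
    deriv (blaschkeMap k (r * u)) u = ((k * (1 - r) / (1 + r) : ℝ) : ℂ) := by
  have hD := blaschkeMap_denom_ne_zero (k := k) (a := r * u) (z := u)
    (by rwa [norm_mul, hu, mul_one, Complex.norm_of_nonneg hr₀]) hu.le
  have hc := conj_mul_self_of_norm_one hu
  have hk' : u ^ k = u := by
    rw [← Nat.sub_add_cancel hk, pow_succ, huk, one_mul]
  have hDr : 1 + (starRingEnd ℂ) (r * u) * u ^ k = 1 + r := by
    rw [map_mul, Complex.conj_ofReal, hk']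
    linear_combination (r : ℂ) * hc
  have h := ((hasDerivAt_pow k u).add_const ((r : ℂ) * u)).div
    (((hasDerivAt_pow k u).const_mul ((starRingEnd ℂ) (r * u))).const_add 1) hD
  have hd : deriv (blaschkeMap k (r * u)) u = _ := h.deriv
  rw [hDr] at hd hD
  rw [hd, huk, hk', map_mul, Complex.conj_ofReal]
  push_cast
  field_simp
  linear_combination (-(k : ℂ) * r) * hc

theorem isParabolicFixedPoint_blaschkeMap_iff {k : ℕ} (hk : 2 ≤ k) {u : ℂ} (hu : ‖u‖ = 1)
    (huk : u ^ (k - 1) = 1) {r : ℝ} (hr₀ : 0 ≤ r) (hr₁ : r < 1) :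
    IsParabolicFixedPoint (blaschkeMap k (r * u)) u ↔ r = ((k : ℝ) - 1) / ((k : ℝ) + 1) := by
  have hk0 : (2 : ℝ) ≤ k := by exact_mod_cast hk
  have hk1 : u ^ k = u := by
    rw [← Nat.sub_add_cancel (by omega : 1 ≤ k), pow_succ, huk, one_mul]
  have ha : ‖(r : ℂ) * u‖ < 1 := by
    rwa [norm_mul, hu, mul_one, Complex.norm_of_nonneg hr₀]
  have hd := deriv_blaschkeMap (by omega) hu huk hr₀ hr₁
  have hiff : k * (1 - r) / (1 + r) = 1 ↔ r = ((k : ℝ) - 1) / ((k : ℝ) + 1) := by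
    rw [div_eq_one_iff_eq (by linarith), eq_div_iff (by linarith)]
    constructor <;> intro h <;> linarith
  constructor
  · rintro ⟨-, -, ⟨n, hn, h⟩, -⟩
    rw [hd, ← Complex.ofReal_pow, Complex.ofReal_eq_one] at h
    have h0 : 0 ≤ k * (1 - r) / (1 + r) :=
      div_nonneg (mul_nonneg (by linarith) (by linarith)) (by linarith)
    exact hiff.1 ((pow_eq_one_iff_of_nonneg h0 hn.ne').1 h)
  · intro hr
    refine ⟨blaschkeMap_analyticAt ha hu.le,
      (isFixedPt_blaschkeMap_iff (by omega) hu hr₀ hr₁).2 huk, ⟨1, one_pos, ?_⟩, fun n hn =>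
      not_eventually_iterate_eq_of_horoRatio_lt hu
        (fun z hz => norm_blaschkeMap_lt_one (by omega) hu hk1 hr₀ hr₁ hz)
        (fun z hz => horoRatio_blaschkeMap_lt hk hu hk1 hr hz) hn⟩
    rw [hd, hiff.2 hr]
    simp

theorem mainTheorem3 (k : ℕ) (hk : 2 ≤ k) (a : ℂ) (ha₀ : 0 < ‖a‖) (ha₁ : ‖a‖ < 1) :
    (Function.IsFixedPt (blaschkeMap k a) (a / (‖a‖ : ℂ)) ↔ (a / (‖a‖ : ℂ)) ^ (k - 1) = 1) ∧
    ((a / (‖a‖ : ℂ)) ^ (k - 1) = 1 →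
      (IsParabolicFixedPoint (blaschkeMap k a) (a / (‖a‖ : ℂ)) ↔
        ‖a‖ = ((k : ℝ) - 1) / ((k : ℝ) + 1))) ∧
    ((a / (‖a‖ : ℂ)) ^ (k - 1) = 1 →
      IsParabolicFixedPoint (blaschkeMap k a) (a / (‖a‖ : ℂ)) →
      ∀ z ∈ Metric.ball (0 : ℂ) 1,
        Filter.Tendsto (fun n : ℕ => (blaschkeMap k a)^[n] z) Filter.atTop
          (nhds (a / (‖a‖ : ℂ)))) := by
  obtain ⟨u, hua⟩ : ∃ u, u = a / (‖a‖ : ℂ) := ⟨_, rfl⟩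
  obtain ⟨r, hra⟩ : ∃ r, r = ‖a‖ := ⟨_, rfl⟩
  have hu : ‖u‖ = 1 := by
    rw [hua, norm_div, Complex.norm_real, norm_norm, div_self ha₀.ne']
  have ha : a = r * u := by
    rw [hua, hra, mul_div_cancel₀]
    exact_mod_cast ha₀.ne'
  rw [← hua, ← hra]
  rw [← hra] at ha₀ ha₁
  subst ha
  refine ⟨isFixedPt_blaschkeMap_iff (by omega) hu ha₀.le ha₁,
    fun huk => isParabolicFixedPoint_blaschkeMap_iff hk hu huk ha₀.le ha₁,
    fun huk hpar z hz => ?_⟩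
  have hr := (isParabolicFixedPoint_blaschkeMap_iff hk hu huk ha₀.le ha₁).1 hpar
  have hk1 : u ^ k = u := by
    rw [← Nat.sub_add_cancel (by omega : 1 ≤ k), pow_succ, huk, one_mul]
  exact tendsto_iterate_of_horoRatio_lt
    (fun z hz => (blaschkeMap_analyticAt (hra ▸ ha₁) hz.le).continuousAt)
    (fun z hz => norm_blaschkeMap_lt_one (by omega) hu hk1 ha₀.le ha₁ hz)
    (fun z hz => horoRatio_blaschkeMap_lt hk hu hk1 hr hz) (by simpa using hz)
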